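/- Let $G$ be a finite simple graph on $n$ vertices that is $2$-connected (i.e. $n\ge 3$, $G$ is connected, and $G-x$ is connected for every vertex $x$) and is not a cycle. Let $K_{1,3}$ be the claw and let $Z_1$ be the path $a_1a_2a_3a_4$ plus the edge $a_1a_3$ (a triangle with one pendant edge). For a graph $R$, call $G$ \emph{$R$-$f_1$-heavy} if for every induced subgraph $H$ of $G$ isomorphic to $R$ and every pair of vertices $u,v\in V(H)$ with $d_H(u,v)=2$ one has $\max\{d(u),d(v)\}\ge (n+1)/2$, where $d_H(u,v)$ is the distance in $H$ and $d(\cdot)$ denotes the degree in $G$. If $G$ is $\{K_{1,3},Z_1\}$-$f_1$-heavy, that is, both $K_{1,3}$-$f_1$-heavy and $Z_1$-$f_1$-heavy, then $G$ is pancyclic: it contains a cycle of every length from $3$ to $n$. -/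

import Mathlib

namespace SimpleGraph

/-- A finite graph is `2`-connected if it has at least three vertices, is connected, and stays
connected after the deletion of any one vertex. -/
def IsTwoConnected {V : Type*} [Fintype V] (G : SimpleGraph V) : Prop :=
  3 ≤ Fintype.card V ∧ G.Connected ∧ ∀ x : V, (G.induce ({x}ᶜ : Set V)).Connected

/-- The whole graph `G` is a cycle (of length at least `3`). -/
def IsCycleGraph {V : Type*} [Fintype V] (G : SimpleGraph V) : Prop :=
  3 ≤ Fintype.card V ∧ Nonempty (G ≃g cycleGraph (Fintype.card V))

/-- A graph on `n` vertices is pancyclic if it contains a cycle of every length `k` with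
`3 ≤ k ≤ n`. -/
def IsPancyclic {V : Type*} [Fintype V] (G : SimpleGraph V) : Prop :=
  ∀ k : ℕ, 3 ≤ k → k ≤ Fintype.card V → ∃ (v : V) (c : G.Walk v v), c.IsCycle ∧ c.length = k

/-- `G`, a graph on `n` vertices, is `R`-`f_i`-heavy: for every induced subgraph `H` of `G`
isomorphic to `R` and all vertices `u, v` of `H` at distance `2` in `H`, the larger of the degrees
of `u` and `v` in `G` is at least `(n + i) / 2`. -/
def IsFHeavy {V W : Type*} [Fintype V] (G : SimpleGraph V) [DecidableRel G.Adj]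
    (R : SimpleGraph W) (i : ℕ) : Prop :=
  ∀ s : Set V, Nonempty (G.induce s ≃g R) → ∀ u v : s, (G.induce s).dist u v = 2 →
    ((Fintype.card V : ℝ) + (i : ℝ)) / 2 ≤ max (G.degree (u : V) : ℝ) (G.degree (v : V) : ℝ)

/-- The claw `K_{1,3}`. -/
abbrev claw : SimpleGraph (Fin 1 ⊕ Fin 3) :=
  completeBipartiteGraph (Fin 1) (Fin 3)

/-- The graph `Z_i`: the path `a_1 a_2 … a_{i+3}` plus the edge `a_1 a_3`
(the vertex `a_{j+1}` is `j : Fin (i + 3)`). -/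
def zGraph (i : ℕ) : SimpleGraph (Fin (i + 3)) :=
  pathGraph (i + 3) ⊔ edge 0 2

end SimpleGraph

/-!
Let `n` be the number of vertices, and call a vertex heavy if its degree is at least `(n + 1) / 2`
and light otherwise. Both heaviness conditions enter through one consequence
(`IsLightCoherent`, from `isLightCoherent_of_isFHeavy`): if `w` has nonadjacent light neighbours
`a` and `c`, then every further neighbour of `w` is adjacent to both `a` and `c`, since otherwise
there would be an induced claw or `Z₁` in which two light vertices have distance two.

If there are no heavy vertices, the graph has maximum degree two and is a cycle
(`IsTwoConnected.isCycleGraph_of_not_isHeavy`). If some heavy vertex has two nonadjacent light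
neighbours, counting shows that the graph is `K₄` without an edge
(`IsLightCoherent.isPancyclic_of_not_adj`). In the remaining case the light neighbours of each heavy
vertex form a clique. So a heavy vertex is attached to at most one component of the graph induced
by the light vertices. By `2`-connectedness, two distinct vertices of such a component `Q` (or the
only vertex of `Q`) are joined to two distinct heavy vertices, and `Q` has a Hamiltonian path
between them (`exists_isChain_of_simplicial`), because the neighbourhoods in `Q` of the ends are
cliques. The paths so obtained for different components are disjoint
(`IsTwoConnected.exists_heavy_path`), and become a Hamiltonian cycle once all heavy vertices are
made adjacent to each other. By the Bondy–Chvátal closure argument, `G` itself is Hamiltonian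
(`IsTwoConnected.exists_isHamOrder`).

A Hamiltonian cycle of `G` has two consecutive heavy vertices: otherwise the light vertices form a
clique, and counting the edges between light and heavy vertices gives a contradiction
(`IsHamOrder.exists_consecutive_isHeavy`). By a theorem of Schmeichel and Hakimi, two consecutive
vertices of degree sum at least `n + 1` on a Hamiltonian cycle yield cycles of all lengths
(`IsHamOrder.isPancyclic_of_degree_add`).
-/

namespace SimpleGraph

/-! ### Hamiltonian cycles as periodic sequences -/

section

variable {V : Type*}

lemma cycleGraph_adj_iff_val {k : ℕ} (hk : 3 ≤ k) (u v : Fin k) :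
    (cycleGraph k).Adj u v ↔ v.val = u.val + 1 ∨ u.val = v.val + 1 ∨
      (u.val = 0 ∧ v.val + 1 = k) ∨ (v.val = 0 ∧ u.val + 1 = k) := by
  rw [cycleGraph_adj']
  have hu := u.isLt
  have hv := v.isLt
  rcases lt_trichotomy u v with h | h | h
  · rw [Fin.coe_sub_iff_lt.mpr h, Fin.coe_sub_iff_le.mpr h.le]
    have := Fin.lt_def.mp h
    omega
  · subst h
    rw [Fin.coe_sub_iff_le.mpr le_rfl]
    omega
  · rw [Fin.coe_sub_iff_lt.mpr h, Fin.coe_sub_iff_le.mpr h.le]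
    have := Fin.lt_def.mp h
    omega

/-- A cyclic sequence of `k ≥ 3` distinct vertices, consecutive ones being adjacent, is a cycle. -/
lemma exists_isCycle_of_injOn {G : SimpleGraph V} {k : ℕ} (hk : 3 ≤ k) (f : ℕ → V)
    (hinj : ∀ i < k, ∀ j < k, f i = f j → i = j)
    (hadj : ∀ i, i + 1 < k → G.Adj (f i) (f (i + 1))) (hclose : G.Adj (f (k - 1)) (f 0)) :
    ∃ (v : V) (c : G.Walk v v), c.IsCycle ∧ c.length = k := by
  refine (cycleGraph_isContained_iff (by omega)).mp ⟨⟨⟨fun i => f i, ?_⟩, ?_⟩⟩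
  · intro u v huv
    rcases (cycleGraph_adj_iff_val hk u v).mp huv with h | h | ⟨h, h'⟩ | ⟨h, h'⟩
    · have := hadj u (by omega)
      rwa [← h] at this
    · have := hadj v (by omega)
      rw [← h] at this
      exact this.symm
    · have e : v.val = k - 1 := by omega
      rw [h, e]
      exact hclose.symm
    · have e : u.val = k - 1 := by omega
      rw [h, e]
      exact hclose
  · intro u v huv
    exact Fin.ext (hinj u u.isLt v v.isLt huv)

/-- A Hamiltonian cycle of `F`, written as a sequence of vertices indexed by `ℕ` that is periodic
with period the number of vertices and runs through every vertex once in each period.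
Being periodic, it may be started at any index. -/
def IsHamOrder [Fintype V] (F : SimpleGraph V) (g : ℕ → V) : Prop :=
  (∀ i, F.Adj (g i) (g (i + 1))) ∧ ∀ i j, g i = g j ↔ i ≡ j [MOD Fintype.card V]

namespace IsHamOrder

variable [Fintype V] {F : SimpleGraph V} {g : ℕ → V}

lemma shift (h : F.IsHamOrder g) (s : ℕ) : F.IsHamOrder fun i => g (i + s) := by
  refine ⟨fun i => ?_, fun i j => ?_⟩
  · have := h.1 (i + s)
    rwa [show i + s + 1 = i + 1 + s by ring] at this
  · rw [h.2]
    exact ⟨Nat.ModEq.add_right_cancel' s, Nat.ModEq.add_right s⟩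

lemma inj (h : F.IsHamOrder g) : ∀ i < Fintype.card V, ∀ j < Fintype.card V, g i = g j → i = j := by
  intro i hi j hj hij
  exact Nat.ModEq.eq_of_lt_of_lt ((h.2 i j).mp hij) hi hj

lemma add_card (h : F.IsHamOrder g) (i : ℕ) : g (i + Fintype.card V) = g i := by
  rw [h.2]
  simp [Nat.ModEq]

lemma ne_add_two (h : F.IsHamOrder g) (hn : 3 ≤ Fintype.card V) (i : ℕ) : g i ≠ g (i + 2) := by
  intro e
  have h1 := (Nat.modEq_iff_dvd' (by omega)).mp ((h.2 i (i + 2)).mp e)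
  have h2 := Nat.le_of_dvd (by omega) h1
  omega

lemma exists_lt (h : F.IsHamOrder g) (x : V) : ∃ i < Fintype.card V, g i = x := by
  classical
  have himg : (Finset.range (Fintype.card V)).image g = Finset.univ := by
    rw [← Finset.card_eq_iff_eq_univ, Finset.card_image_of_injOn, Finset.card_range]
    intro i hi j hj hij
    simp only [Finset.coe_range, Set.mem_Iio] at hi hj
    exact h.inj i hi j hj hij
  have := Finset.mem_univ x
  rw [← himg, Finset.mem_image] at this
  obtain ⟨i, hi, rfl⟩ := this
  exact ⟨i, Finset.mem_range.mp hi, rfl⟩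

lemma of_injOn (f : ℕ → V)
    (hinj : ∀ i < Fintype.card V, ∀ j < Fintype.card V, f i = f j → i = j)
    (hadj : ∀ i, i + 1 < Fintype.card V → F.Adj (f i) (f (i + 1)))
    (hclose : F.Adj (f (Fintype.card V - 1)) (f 0)) :
    F.IsHamOrder fun i => f (i % Fintype.card V) := by
  have hpos : 0 < Fintype.card V := Fintype.card_pos_iff.mpr ⟨f 0⟩
  refine ⟨fun i => ?_, fun i j => ?_⟩
  · dsimp only
    have hi := Nat.mod_lt i hpos
    by_cases hlast : i % Fintype.card V + 1 < Fintype.card V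
    · have : (i + 1) % Fintype.card V = i % Fintype.card V + 1 := by
        rw [Nat.add_mod, Nat.mod_eq_of_lt (a := 1) (by omega), Nat.mod_eq_of_lt hlast]
      rw [this]
      exact hadj _ hlast
    · have e : i % Fintype.card V = Fintype.card V - 1 := by omega
      have : (i + 1) % Fintype.card V = 0 := by
        have h1 : (i + 1) % Fintype.card V = (i % Fintype.card V + 1) % Fintype.card V := by
          simp
        rw [h1, e, Nat.sub_add_cancel hpos, Nat.mod_self]
      rw [this, e]
      exact hclose
  · exact ⟨fun h => hinj _ (Nat.mod_lt i hpos) _ (Nat.mod_lt j hpos) h, fun h => by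
      dsimp only
      rw [show i % Fintype.card V = j % Fintype.card V from h]⟩

lemma exists_of_list (hn : 3 ≤ Fintype.card V) {l : List V} (hl : l.Nodup) (hall : ∀ x, x ∈ l)
    (hchain : l.IsChain F.Adj)
    (hclose : ∀ a ∈ l.head?, ∀ b ∈ l.getLast?, a ≠ b → F.Adj b a) : ∃ g, F.IsHamOrder g := by
  classical
  have hcard : l.length = Fintype.card V := by
    rw [← List.toFinset_card_of_nodup hl, ← Finset.card_univ]
    congr 1
    ext x
    simpa using hall x
  have hlt : ∀ {i}, i < Fintype.card V → i < l.length := fun hi => hcard ▸ hi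
  obtain ⟨x₀⟩ : Nonempty V := Fintype.card_pos_iff.mp (by omega)
  have hget : ∀ i (hi : i < Fintype.card V), l.getD i x₀ = l[i]'(hlt hi) := fun i hi =>
    List.getD_eq_getElem _ _ (hlt hi)
  have hinj : ∀ i < Fintype.card V, ∀ j < Fintype.card V, l.getD i x₀ = l.getD j x₀ → i = j := by
    intro i hi j hj hij
    rw [hget i hi, hget j hj] at hij
    exact (hl.getElem_inj_iff).mp hij
  refine ⟨_, IsHamOrder.of_injOn (fun i => l.getD i x₀) hinj ?_ ?_⟩
  · intro i hi
    rw [hget i (by omega), hget (i + 1) hi]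
    exact List.isChain_iff_getElem.mp hchain i (hlt hi)
  · refine hclose _ ?_ _ ?_ fun e => ?_
    · rw [hget _ (by omega), List.head?_eq_getElem?]
      exact List.getElem?_eq_getElem _
    · rw [hget _ (by omega), List.getLast?_eq_getElem?, hcard]
      exact List.getElem?_eq_getElem _
    · have := hinj _ (by omega) _ (by omega) e
      omega

/-- Each neighbour of `x` occurs once in a period. -/
lemma card_filter_adj (h : F.IsHamOrder g) (G : SimpleGraph V) [DecidableRel G.Adj] (x : V) :
    ((Finset.range (Fintype.card V)).filter fun i => G.Adj x (g i)).card = G.degree x := by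
  classical
  rw [← G.card_neighborFinset_eq_degree, ← Finset.card_image_of_injOn (f := g)]
  · congr 1
    ext y
    simp only [Finset.mem_image, Finset.mem_filter, Finset.mem_range, mem_neighborFinset]
    constructor
    · rintro ⟨i, ⟨-, hi⟩, rfl⟩
      exact hi
    · intro hy
      obtain ⟨i, hi, rfl⟩ := h.exists_lt y
      exact ⟨i, ⟨hi, hy⟩, rfl⟩
  · intro i hi j hj hij
    simp only [Finset.coe_filter, Finset.mem_range, Set.mem_ofPred_eq] at hi hj
    exact h.inj i hi.1 j hj.1 hij

end IsHamOrder

/-- A Hamiltonian cycle of a graph all of whose degrees are at most two uses every edge. -/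
lemma IsHamOrder.isCycleGraph [Fintype V] {G : SimpleGraph V} [DecidableRel G.Adj] {g : ℕ → V}
    (hg : G.IsHamOrder g) (hn : 3 ≤ Fintype.card V) (hdeg : ∀ x, G.degree x ≤ 2) :
    G.IsCycleGraph := by
  classical
  set n := Fintype.card V with hnd
  have hnbr : ∀ i y, G.Adj (g (i + 1)) y → y = g i ∨ y = g (i + 2) := by
    intro i y hy
    by_contra! hne
    have hne' : g i ≠ g (i + 2) := hg.ne_add_two hn i
    have hsub : ({y, g i, g (i + 2)} : Finset V) ⊆ G.neighborFinset (g (i + 1)) := by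
      intro z hz
      simp only [Finset.mem_insert, Finset.mem_singleton] at hz
      rw [mem_neighborFinset]
      rcases hz with rfl | rfl | rfl
      · exact hy
      · exact (hg.1 i).symm
      · exact hg.1 (i + 1)
    have h1 := Finset.card_le_card hsub
    rw [Finset.card_eq_three.mpr ⟨y, g i, g (i + 2), hne.1, hne.2, hne', rfl⟩] at h1
    have := hdeg (g (i + 1))
    rw [← G.card_neighborFinset_eq_degree] at this
    omega
  refine ⟨hn, ⟨RelIso.symm ⟨Equiv.ofBijective (fun i : Fin n => g i) ⟨?_, ?_⟩, ?_⟩⟩⟩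
  · intro i j hij
    exact Fin.ext (hg.inj i i.isLt j j.isLt hij)
  · intro x
    obtain ⟨i, hi, rfl⟩ := hg.exists_lt x
    exact ⟨⟨i, hi⟩, rfl⟩
  · intro u v
    change G.Adj (g u) (g v) ↔ _
    rw [cycleGraph_adj_iff_val hn]
    have hn0 : g n = g 0 := by simpa using hg.add_card 0
    have hlast : G.Adj (g (n - 1)) (g 0) := by
      have := hg.1 (n - 1)
      rwa [Nat.sub_add_cancel (by omega), hn0] at this
    have hu := u.isLt
    have hv := v.isLt
    constructor
    · intro h
      rcases Nat.eq_zero_or_pos u.val with h0 | h0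
      · have h' : G.Adj (g (n - 1 + 1)) (g v) := by
          rwa [Nat.sub_add_cancel (by omega), hn0, ← h0]
        rcases hnbr _ _ h' with h1 | h1
        · have := hg.inj _ hv _ (by omega) h1
          omega
        · rw [show n - 1 + 2 = 1 + n by omega, hg.add_card] at h1
          have := hg.inj _ hv _ (by omega) h1
          omega
      · have h' : G.Adj (g (u.val - 1 + 1)) (g v) := by
          rwa [Nat.sub_add_cancel h0]
        rcases hnbr _ _ h' with h1 | h1
        · have := hg.inj _ hv _ (by omega) h1
          omega
        · by_cases hun : u.val + 1 < n
          · have := hg.inj _ hv _ (by omega) h1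
            omega
          · rw [show u.val - 1 + 2 = 0 + n by omega, hg.add_card] at h1
            have := hg.inj _ hv _ (by omega) h1
            omega
    · rintro (h | h | ⟨h, h'⟩ | ⟨h, h'⟩)
      · rw [h]; exact hg.1 _
      · rw [h]; exact (hg.1 _).symm
      · rw [h, show v.val = n - 1 by omega]; exact hlast.symm
      · rw [h, show u.val = n - 1 by omega]; exact hlast

end

/-! ### Degree sums on Hamiltonian cycles -/

section

variable {V : Type*} [Fintype V] {G : SimpleGraph V} [DecidableRel G.Adj]

namespace IsHamOrder

variable {F : SimpleGraph V} {g : ℕ → V}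

/-- If two consecutive vertices of a Hamiltonian cycle have degree sum greater than the number of
vertices, then there are cycles of all lengths (Schmeichel and Hakimi). -/
lemma isPancyclic_of_degree_add (hg : G.IsHamOrder g)
    (hdeg : Fintype.card V + 1 ≤ G.degree (g 0) + G.degree (g (Fintype.card V - 1))) :
    G.IsPancyclic := by
  classical
  intro k hk hkn
  set n := Fintype.card V with hnd
  -- A cycle of length `k` arises from `j` with `g 0` adjacent to `g j` and `g (n - 1)` adjacent
  -- to `g (σ j)`: it closes up through the segment from `g j` to `g (σ j)`, or, when `σ j < j`,
  -- through the two segments that remain outside. As `σ` permutes the interior indices,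
  -- the degree sum forces such a `j` by counting.
  let σ : ℕ → ℕ := fun j => if j + k ≤ n + 1 then j + k - 3 else j + k - 1 - n
  let I := (Finset.Ico 1 (n - 1)).filter fun j => G.Adj (g 0) (g j)
  let J := (Finset.Ico 1 (n - 1)).filter fun j => G.Adj (g (n - 1)) (g (σ j))
  have hI : G.degree (g 0) ≤ I.card + 1 := by
    rw [← hg.card_filter_adj G (g 0)]
    refine (Finset.card_le_card ?_).trans (Finset.card_insert_le (n - 1) I)
    intro i hi
    simp only [Finset.mem_filter, Finset.mem_range, Finset.mem_insert, Finset.mem_Ico, I] at hi ⊢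
    have h0 : i ≠ 0 := by
      rintro rfl
      exact G.irrefl hi.2
    by_cases h : i = n - 1
    · exact Or.inl h
    · exact Or.inr ⟨by omega, hi.2⟩
  have hJ : G.degree (g (n - 1)) ≤ J.card + 1 := by
    rw [← hg.card_filter_adj G (g (n - 1))]
    refine (Finset.card_le_card (t := insert 0 (J.image σ)) ?_).trans
      ((Finset.card_insert_le _ _).trans (Nat.add_le_add_right Finset.card_image_le 1))
    intro i hi
    simp only [Finset.mem_filter, Finset.mem_range, Finset.mem_insert, Finset.mem_Ico,
      Finset.mem_image, J] at hi ⊢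
    have h0 : i ≠ n - 1 := by
      rintro rfl
      exact G.irrefl hi.2
    by_cases h : i = 0
    · exact Or.inl h
    · right
      have hσ : ∃ j, (1 ≤ j ∧ j < n - 1) ∧ σ j = i := by
        by_cases hik : k - 2 ≤ i
        · refine ⟨i + 3 - k, by omega, ?_⟩
          simp only [σ]
          rw [if_pos (by omega)]
          omega
        · refine ⟨i + n + 1 - k, by omega, ?_⟩
          simp only [σ]
          rw [if_neg (by omega)]
          omega
      obtain ⟨j, hj, hji⟩ := hσ
      exact ⟨j, ⟨hj, by rw [hji]; exact hi.2⟩, hji⟩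
  obtain ⟨j, hj⟩ := Finset.inter_nonempty_of_card_lt_card_add_card
    (s := Finset.Ico 1 (n - 1)) (t := I) (u := J) (Finset.filter_subset _ _)
    (Finset.filter_subset _ _) (by rw [Nat.card_Ico]; omega)
  simp only [Finset.mem_inter, Finset.mem_filter, Finset.mem_Ico, I, J, σ] at hj
  obtain ⟨⟨hj1, hj0⟩, -, hjσ⟩ := hj
  have hclose : G.Adj (g (n - 1)) (g 0) := by
    have := hg.1 (n - 1)
    rw [Nat.sub_add_cancel (by omega)] at this
    rwa [show g n = g 0 by simpa using hg.add_card 0] at this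
  split_ifs at hjσ with h
  · let τ : ℕ → ℕ := fun t => if t = 0 then 0 else if t = k - 1 then n - 1 else j + t - 1
    refine exists_isCycle_of_injOn hk (fun t => g (τ t)) ?_ ?_ ?_
    · intro a ha b hb hab
      have := hg.inj (τ a) (by simp only [τ]; split_ifs <;> omega) (τ b)
        (by simp only [τ]; split_ifs <;> omega) hab
      simp only [τ] at this
      split_ifs at this <;> omega
    · intro t ht
      by_cases h0 : t = 0
      · have e1 : τ t = 0 := by simp only [τ]; rw [if_pos h0]
        have e2 : τ (t + 1) = j := by
          simp only [τ]; rw [if_neg (by omega), if_neg (by omega)]; omega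
        rw [e1, e2]
        exact hj0
      · by_cases hl : t + 1 = k - 1
        · have e1 : τ t = j + k - 3 := by
            simp only [τ]; rw [if_neg h0, if_neg (by omega)]; omega
          have e2 : τ (t + 1) = n - 1 := by
            simp only [τ]; rw [if_neg (by omega), if_pos hl]
          rw [e1, e2]
          exact hjσ.symm
        · have e2 : τ (t + 1) = τ t + 1 := by
            simp only [τ]
            rw [if_neg (by omega), if_neg hl, if_neg h0, if_neg (by omega)]; omega
          rw [e2]
          exact hg.1 _
    · have e1 : τ (k - 1) = n - 1 := by
        simp only [τ]; rw [if_neg (by omega), if_pos trivial]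
      have e2 : τ 0 = 0 := by simp only [τ]; rw [if_pos trivial]
      rw [e1, e2]
      exact hclose
  · set i := j + k - 1 - n with hi
    let τ : ℕ → ℕ := fun t => if t ≤ i then t else n + i - t
    refine exists_isCycle_of_injOn hk (fun t => g (τ t)) ?_ ?_ ?_
    · intro a ha b hb hab
      have := hg.inj (τ a) (by simp only [τ]; split_ifs <;> omega) (τ b)
        (by simp only [τ]; split_ifs <;> omega) hab
      simp only [τ] at this
      split_ifs at this <;> omega
    · intro t ht
      rcases lt_trichotomy t i with h0 | h0 | h0
      · have e1 : τ t = t := by simp only [τ]; rw [if_pos (by omega)]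
        have e2 : τ (t + 1) = t + 1 := by simp only [τ]; rw [if_pos (by omega)]
        rw [e1, e2]
        exact hg.1 t
      · have e1 : τ t = i := by simp only [τ]; rw [if_pos (by omega), h0]
        have e2 : τ (t + 1) = n - 1 := by simp only [τ]; rw [if_neg (by omega)]; omega
        rw [e1, e2]
        exact hjσ.symm
      · have e1 : τ t = τ (t + 1) + 1 := by
          simp only [τ]; rw [if_neg (by omega), if_neg (by omega)]; omega
        rw [e1]
        exact (hg.1 _).symm
    · have e1 : τ (k - 1) = j := by
        simp only [τ]; rw [if_neg (by omega)]; omega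
      have e2 : τ 0 = 0 := by simp only [τ]; rw [if_pos (by omega)]
      rw [e1, e2]
      exact hj0.symm

/-- The crossing pair of chords in Ore's theorem: it closes the path from `g 0` to `g (n - 1)` up
to a cycle without the edge between these two vertices. -/
lemma exists_crossing (hg : F.IsHamOrder g)
    (hdeg : Fintype.card V ≤ G.degree (g 0) + G.degree (g (Fintype.card V - 1))) :
    ∃ i, i + 1 < Fintype.card V ∧ G.Adj (g 0) (g (i + 1)) ∧
      G.Adj (g (Fintype.card V - 1)) (g i) := by
  classical
  have hpos : 0 < Fintype.card V := Fintype.card_pos_iff.mpr ⟨g 0⟩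
  set n := Fintype.card V with hnd
  let I := (Finset.range (n - 1)).filter fun i => G.Adj (g 0) (g (i + 1))
  let J := (Finset.range (n - 1)).filter fun i => G.Adj (g (n - 1)) (g i)
  have hI : G.degree (g 0) ≤ I.card := by
    rw [← hg.card_filter_adj G (g 0)]
    refine (Finset.card_le_card (t := I.image (· + 1)) ?_).trans Finset.card_image_le
    intro i hi
    simp only [Finset.mem_filter, Finset.mem_range, Finset.mem_image, I] at hi ⊢
    have h0 : i ≠ 0 := by
      rintro rfl
      exact G.irrefl hi.2
    refine ⟨i - 1, ⟨by omega, ?_⟩, by omega⟩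
    rw [Nat.sub_add_cancel (by omega)]
    exact hi.2
  have hJ : G.degree (g (n - 1)) ≤ J.card := by
    rw [← hg.card_filter_adj G (g (n - 1))]
    refine Finset.card_le_card ?_
    intro i hi
    simp only [Finset.mem_filter, Finset.mem_range, J] at hi ⊢
    have h0 : i ≠ n - 1 := by
      rintro rfl
      exact G.irrefl hi.2
    exact ⟨by omega, hi.2⟩
  obtain ⟨i, hi⟩ := Finset.inter_nonempty_of_card_lt_card_add_card
    (s := Finset.range (n - 1)) (t := I) (u := J) (Finset.filter_subset _ _)
    (Finset.filter_subset _ _) (by rw [Finset.card_range]; omega)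
  simp only [Finset.mem_inter, Finset.mem_filter, Finset.mem_range, I, J] at hi
  exact ⟨i, by omega, hi.1.2, hi.2.2⟩

/-- One step of the Bondy–Chvátal closure, backwards: an edge whose ends are nonadjacent in `G`
and have large degree sum there is not needed for a Hamiltonian cycle. -/
lemma exists_deleteEdges (hn : 3 ≤ Fintype.card V) (hGF : G ≤ F) (hg : F.IsHamOrder g) {u v : V}
    (huv : ¬ G.Adj u v) (hdeg : Fintype.card V ≤ G.degree u + G.degree v) :
    ∃ g', (F.deleteEdges {s(u, v)}).IsHamOrder g' := by
  set n := Fintype.card V with hnd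
  have hle : ∀ x y, G.Adj x y → (F.deleteEdges {s(u, v)}).Adj x y := by
    intro x y hxy
    rw [deleteEdges_adj]
    refine ⟨hGF hxy, ?_⟩
    rw [Set.mem_singleton_iff, Sym2.eq_iff]
    rintro (⟨rfl, rfl⟩ | ⟨rfl, rfl⟩)
    · exact huv hxy
    · exact huv hxy.symm
  by_cases hall : ∀ i, s(g i, g (i + 1)) ≠ s(u, v)
  · refine ⟨g, fun i => ?_, hg.2⟩
    rw [deleteEdges_adj]
    exact ⟨hg.1 i, hall i⟩
  · push Not at hall
    obtain ⟨s, hs⟩ := hall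
    -- Start the cycle so that the edge to be removed is the one closing it.
    obtain ⟨g₁, hg₁, hs₁⟩ : ∃ g₁, F.IsHamOrder g₁ ∧ s(g₁ (n - 1), g₁ 0) = s(u, v) := by
      refine ⟨_, hg.shift (s + 1), ?_⟩
      rw [← hs]
      rw [show n - 1 + (s + 1) = s + n by omega, hg.add_card, zero_add]
    have hdeg₁ : n ≤ G.degree (g₁ 0) + G.degree (g₁ (n - 1)) := by
      rcases Sym2.eq_iff.mp hs₁ with ⟨h1, h2⟩ | ⟨h1, h2⟩
      · rw [h1, h2]; omega
      · rw [h1, h2]; omega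
    obtain ⟨i, hi, hi1, hi2⟩ := hg₁.exists_crossing hdeg₁
    have hstep : ∀ t, t + 1 < n → (F.deleteEdges {s(u, v)}).Adj (g₁ t) (g₁ (t + 1)) := by
      intro t ht
      rw [deleteEdges_adj]
      refine ⟨hg₁.1 t, ?_⟩
      rw [Set.mem_singleton_iff, ← hs₁, Sym2.eq_iff]
      rintro (⟨h1, h2⟩ | ⟨h1, h2⟩)
      · have := hg₁.inj _ ht _ (by omega) h2
        omega
      · have := hg₁.inj _ ht _ (by omega) h2
        have := hg₁.inj t (by omega) _ (by omega) h1
        omega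
    let τ : ℕ → ℕ := fun t => if t ≤ i then t else n + i - t
    have hτ0 : τ 0 = 0 := by simp only [τ]; rw [if_pos (by omega)]
    refine ⟨_, IsHamOrder.of_injOn (fun t => g₁ (τ t)) ?_ ?_ ?_⟩
    · intro a ha b hb hab
      have := hg₁.inj (τ a) (by simp only [τ]; split_ifs <;> omega) (τ b)
        (by simp only [τ]; split_ifs <;> omega) hab
      simp only [τ] at this
      split_ifs at this <;> omega
    · intro t ht
      rcases lt_trichotomy t i with h0 | h0 | h0
      · have e1 : τ t = t := by simp only [τ]; rw [if_pos (by omega)]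
        have e2 : τ (t + 1) = t + 1 := by simp only [τ]; rw [if_pos (by omega)]
        rw [e1, e2]
        exact hstep t (by omega)
      · have e1 : τ t = i := by simp only [τ]; rw [if_pos (by omega), h0]
        have e2 : τ (t + 1) = n - 1 := by simp only [τ]; rw [if_neg (by omega)]; omega
        rw [e1, e2]
        exact hle _ _ hi2.symm
      · have e1 : τ t = τ (t + 1) + 1 := by
          simp only [τ]; rw [if_neg (by omega), if_neg (by omega)]; omega
        rw [e1]
        refine (hstep _ ?_).symm
        simp only [τ]
        rw [if_neg (by omega)]
        omega
    · rw [hτ0, ← hnd]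
      by_cases h : i = n - 1
      · omega
      · have e1 : τ (n - 1) = i + 1 := by
          simp only [τ]; rw [if_neg (by omega)]; omega
        rw [e1]
        exact hle _ _ hi1.symm

/-- The Bondy–Chvátal closure argument: adding edges between vertices of degree sum at least the
number of vertices does not create Hamiltonicity. -/
lemma exists_of_degree_add (hn : 3 ≤ Fintype.card V) (hGF : G ≤ F) (hg : F.IsHamOrder g)
    (hdeg : ∀ u v, F.Adj u v → ¬ G.Adj u v → Fintype.card V ≤ G.degree u + G.degree v) :
    ∃ g', G.IsHamOrder g' := by
  classical
  -- A minimal Hamiltonian graph between `G` and `F` is `G` itself.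
  obtain ⟨F₀, ⟨⟨hGF₀, hF₀F, g₀, hg₀⟩, hmin⟩⟩ :=
    (Set.toFinite {F' : SimpleGraph V | G ≤ F' ∧ F' ≤ F ∧ ∃ g, F'.IsHamOrder g}).exists_minimal
      ⟨F, hGF, le_rfl, g, hg⟩
  have hF₀ : F₀ ≤ G := by
    intro u v huv
    by_contra hnot
    obtain ⟨g', hg'⟩ := exists_deleteEdges hn hGF₀ hg₀ hnot (hdeg u v (hF₀F huv) hnot)
    have hG' : G ≤ F₀.deleteEdges {s(u, v)} := by
      intro x y hxy
      rw [deleteEdges_adj]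
      refine ⟨hGF₀ hxy, ?_⟩
      rw [Set.mem_singleton_iff, Sym2.eq_iff]
      rintro (⟨rfl, rfl⟩ | ⟨rfl, rfl⟩)
      · exact hnot hxy
      · exact hnot hxy.symm
    have := hmin ⟨hG', (deleteEdges_le _).trans hF₀F, g', hg'⟩ (deleteEdges_le _) huv
    rw [deleteEdges_adj] at this
    exact this.2 rfl
  exact ⟨g₀, fun i => hF₀ (hg₀.1 i), hg₀.2⟩

end IsHamOrder

end

/-! ### Edge cuts in 2-connected graphs -/

section

variable {V : Type*}

lemma Connected.exists_adj_boundary {G : SimpleGraph V} (h : G.Connected) {S : Set V} {y z : V}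
    (hy : y ∈ S) (hz : z ∉ S) : ∃ u ∈ S, ∃ v ∉ S, G.Adj u v := by
  obtain ⟨p⟩ := h.preconnected y z
  obtain ⟨d, -, h1, h2⟩ := p.exists_boundary_dart S hy hz
  exact ⟨d.fst, h1, d.snd, h2, d.adj⟩

namespace IsTwoConnected

variable [Fintype V] {G : SimpleGraph V}

lemma exists_adj_boundary (h : G.IsTwoConnected) (x : V) {S : Set V} {y z : V}
    (hy : y ∈ S) (hz : z ∉ S) (hyx : y ≠ x) (hzx : z ≠ x) :
    ∃ u ∈ S, ∃ v ∉ S, u ≠ x ∧ v ≠ x ∧ G.Adj u v := by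
  obtain ⟨u, hu, v, hv, huv⟩ := (h.2.2 x).exists_adj_boundary
    (S := {w : ({x}ᶜ : Set V) | (w : V) ∈ S}) (y := ⟨y, hyx⟩) (z := ⟨z, hzx⟩) hy hz
  exact ⟨u, hu, v, hv, u.2, v.2, huv⟩

lemma exists_adj_ne (h : G.IsTwoConnected) {x y : V} (hxy : x ≠ y) : ∃ z, z ≠ y ∧ G.Adj x z := by
  classical
  obtain ⟨z, hz⟩ : ∃ z, z ∉ ({x, y} : Finset V) := by
    by_contra! hall
    have h1 : Fintype.card V ≤ ({x, y} : Finset V).card :=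
      Finset.card_le_card fun z _ => hall z
    have h2 := Finset.card_le_two (a := x) (b := y)
    have h3 := h.1
    omega
  simp only [Finset.mem_insert, Finset.mem_singleton, not_or] at hz
  obtain ⟨u, hu, v, -, -, hvy, huv⟩ :=
    h.exists_adj_boundary y (S := {x}) (y := x) (z := z) rfl hz.1 hxy hz.2
  rw [Set.mem_singleton_iff] at hu
  subst hu
  exact ⟨v, hvy, huv⟩

lemma exists_two_adj (h : G.IsTwoConnected) (x : V) :
    ∃ y z, y ≠ z ∧ G.Adj x y ∧ G.Adj x z := by
  have : Nontrivial V := Fintype.one_lt_card_iff_nontrivial.mp (by have := h.1; omega)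
  obtain ⟨w, hw⟩ := exists_ne x
  obtain ⟨y, -, hy⟩ := h.exists_adj_ne hw.symm
  obtain ⟨z, hz, hxz⟩ := h.exists_adj_ne hy.ne
  exact ⟨y, z, hz.symm, hy, hxz⟩

/-- The case of Menger's theorem for two disjoint edges across a cut. -/
lemma exists_disjoint_adj (h : G.IsTwoConnected) {Q : Set V} {x y : V} (hx : x ∈ Q) (hy : y ∈ Q)
    (hxy : x ≠ y) {z w : V} (hz : z ∉ Q) (hw : w ∉ Q) (hzw : z ≠ w) :
    ∃ a ∈ Q, ∃ c ∈ Q, ∃ u ∉ Q, ∃ v ∉ Q, a ≠ c ∧ u ≠ v ∧ G.Adj a u ∧ G.Adj c v := by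
  have hout : ∀ t, ∃ s, s ∉ Q ∧ s ≠ t := by
    intro t
    by_cases hzt : z = t
    · exact ⟨w, hw, fun e => hzw (hzt.trans e.symm)⟩
    · exact ⟨z, hz, hzt⟩
  have hin : ∀ t, ∃ s, s ∈ Q ∧ s ≠ t := by
    intro t
    by_cases hxt : x = t
    · exact ⟨y, hy, fun e => hxy (hxt.trans e.symm)⟩
    · exact ⟨x, hx, hxt⟩
  obtain ⟨a, ha, u, hu, hau⟩ := h.2.1.exists_adj_boundary hx hz
  obtain ⟨x', hx', hxa⟩ := hin a
  obtain ⟨c, hc, v, hv, hca, -, hcv⟩ := h.exists_adj_boundary a hx' hu hxa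
    (fun e => hu (e ▸ ha))
  by_cases huv : u = v
  · subst huv
    obtain ⟨z', hz', hzu⟩ := hout u
    obtain ⟨d, hd, t, ht, -, htu, hdt⟩ := h.exists_adj_boundary u ha hz'
      (fun e => hu (e ▸ ha)) hzu
    by_cases hda : d = a
    · exact ⟨d, hd, c, hc, t, ht, u, hu, fun e => hca (e ▸ hda), htu, hdt, hcv⟩
    · exact ⟨d, hd, a, ha, t, ht, u, hu, hda, htu, hdt, hau⟩
  · exact ⟨a, ha, c, hc, u, hu, v, hv, hca.symm, huv, hau, hcv⟩

end IsTwoConnected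

end

/-! ### Hamiltonian paths between simplicial vertices -/

section

variable {V : Type*}

/-- Let `Q` be connected, and suppose that whenever `w` has two nonadjacent neighbours in `Q`, all
further neighbours of `w` in `Q` are adjacent to both. Then two vertices of `Q` whose neighbours
in `Q` form cliques are joined by a Hamiltonian path of `Q`. The path can be built greedily: after
the removal of its first vertex `a`, every neighbour of `a` has a clique as its neighbourhood.

Connectedness is the statement that a set which contains `a` and is closed under adjacency in `Q`
contains `Q`. -/
lemma exists_isChain_of_simplicial (G : SimpleGraph V) (Q : Finset V) (a c : V)
    (haQ : a ∈ Q) (hcQ : c ∈ Q) (hac : a ≠ c)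
    (hstar : ∀ w ∈ Q, ∀ x ∈ Q, ∀ y ∈ Q, ∀ z ∈ Q, x ≠ z → ¬ G.Adj x z → G.Adj w x → G.Adj w z →
      G.Adj w y → y ≠ x → y ≠ z → G.Adj x y)
    (ha : ∀ x ∈ Q, ∀ y ∈ Q, G.Adj a x → G.Adj a y → x ≠ y → G.Adj x y)
    (hc : ∀ x ∈ Q, ∀ y ∈ Q, G.Adj c x → G.Adj c y → x ≠ y → G.Adj x y)
    (hconn : ∀ S : Set V, a ∈ S → (∀ y ∈ S, ∀ z ∈ Q, G.Adj y z → z ∈ S) → ∀ y ∈ Q, y ∈ S) :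
    ∃ l : List V, (a :: l).Nodup ∧ (a :: l).IsChain G.Adj ∧ (a :: l).getLast? = some c ∧
      ∀ y, y ∈ a :: l ↔ y ∈ Q := by
  classical
  induction hm : Q.card generalizing Q a with
  | zero =>
    rw [Finset.card_eq_zero] at hm
    subst hm
    exact absurd haQ (Finset.notMem_empty a)
  | succ m ih =>
  by_cases h : ∃ a' ∈ Q, G.Adj a a' ∧ a' ≠ c
  · obtain ⟨a', ha'Q, haa', ha'c⟩ := h
    have hmem : ∀ {y}, y ∈ Q.erase a → y ∈ Q := Finset.mem_of_mem_erase
    obtain ⟨l, hl1, hl2, hl3, hl4⟩ := ih (Q.erase a) a'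
      (Finset.mem_erase.mpr ⟨haa'.ne', ha'Q⟩) (Finset.mem_erase.mpr ⟨hac.symm, hcQ⟩) ha'c
      (fun w hw x hx y hy z hz => hstar w (hmem hw) x (hmem hx) y (hmem hy) z (hmem hz))
      (by
        -- Two nonadjacent neighbours of `a'` other than `a` would both be adjacent to `a`.
        intro x hx y hy hx' hy' hxy
        by_contra hnot
        have h1 : G.Adj x a := hstar a' ha'Q x (hmem hx) a haQ y (hmem hy) hxy hnot hx' hy'
          haa'.symm (Finset.ne_of_mem_erase hx).symm (Finset.ne_of_mem_erase hy).symm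
        have h2 : G.Adj y a := hstar a' ha'Q y (hmem hy) a haQ x (hmem hx) hxy.symm
          (fun e => hnot e.symm) hy' hx' haa'.symm (Finset.ne_of_mem_erase hy).symm
          (Finset.ne_of_mem_erase hx).symm
        exact hnot (ha x (hmem hx) y (hmem hy) h1.symm h2.symm hxy))
      (fun x hx y hy => hc x (hmem hx) y (hmem hy))
      (by
        intro S haS hS y hy
        have := hconn (insert a S) (Set.mem_insert _ _) ?_ y (hmem hy)
        · exact this.resolve_left (Finset.ne_of_mem_erase hy)
        · intro u hu z hz huz
          by_cases hza : z = a
          · exact Or.inl hza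
          have hz' : z ∈ Q.erase a := Finset.mem_erase.mpr ⟨hza, hz⟩
          right
          rcases hu with rfl | hu
          · by_cases hza' : z = a'
            · rwa [hza']
            · exact hS a' haS z hz' (ha a' ha'Q z hz haa' huz (Ne.symm hza'))
          · exact hS u hu z hz' huz)
      (by rw [Finset.card_erase_of_mem haQ, hm]; rfl)
    refine ⟨a' :: l, ?_, ?_, ?_, ?_⟩
    · rw [List.nodup_cons]
      refine ⟨fun hmem' => ?_, hl1⟩
      exact Finset.notMem_erase a Q ((hl4 a).mp hmem')
    · exact List.isChain_cons_cons.mpr ⟨haa', hl2⟩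
    · rw [List.getLast?_cons_cons]
      exact hl3
    · intro y
      rw [List.mem_cons, hl4, Finset.mem_erase]
      constructor
      · rintro (rfl | h)
        · exact haQ
        · exact h.2
      · intro hy
        by_cases hya : y = a
        · exact Or.inl hya
        · exact Or.inr ⟨hya, hy⟩
  · push Not at h
    have hadj : G.Adj a c := by
      by_contra hnot
      have := hconn {a} rfl ?_ c hcQ
      · exact hac (Set.mem_singleton_iff.mp this).symm
      · intro y hy z hz hyz
        rw [Set.mem_singleton_iff.mp hy] at hyz
        exact absurd (h z hz hyz ▸ hyz) hnot
    have hQ := hconn {a, c} (Or.inl rfl) (by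
      intro y hy z hz hyz
      rcases hy with rfl | hy
      · exact Or.inr (h z hz hyz)
      · rw [Set.mem_singleton_iff.mp hy] at hyz
        by_cases hza : z = a
        · exact Or.inl hza
        · exact absurd (h z hz (hc a haQ z hz hadj.symm hyz (Ne.symm hza))) hyz.ne')
    refine ⟨[c], by simpa using hac, by simpa using hadj, rfl, ?_⟩
    intro y
    simp only [List.mem_cons, List.not_mem_nil, or_false]
    constructor
    · rintro (rfl | rfl)
      · exact haQ
      · exact hcQ
    · exact fun hy => hQ y hy

end

/-! ### A Hamiltonian cycle through the heavy vertices -/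

section

variable {V : Type*} [Fintype V]

/-- A vertex of degree at least `(n + 1) / 2`, where `n` is the number of vertices. The vertices
that are not heavy are called light. -/
def IsHeavy (G : SimpleGraph V) [DecidableRel G.Adj] (x : V) : Prop :=
  Fintype.card V + 1 ≤ 2 * G.degree x

/-- Whenever a vertex `w` has two nonadjacent light neighbours `a` and `c`, every further neighbour
of `w` is adjacent to `a` (and by symmetry to `c`). -/
def IsLightCoherent (G : SimpleGraph V) [DecidableRel G.Adj] : Prop :=
  ∀ w a b c, ¬ G.IsHeavy a → ¬ G.IsHeavy c → a ≠ c → ¬ G.Adj a c →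
    G.Adj w a → G.Adj w c → G.Adj w b → b ≠ a → b ≠ c → G.Adj a b

/-- The light neighbours of each heavy vertex form a clique. -/
def HasLightCliques (G : SimpleGraph V) [DecidableRel G.Adj] : Prop :=
  ∀ h a c, G.IsHeavy h → ¬ G.IsHeavy a → ¬ G.IsHeavy c → G.Adj h a → G.Adj h c → a ≠ c → G.Adj a c

variable {G : SimpleGraph V} [DecidableRel G.Adj]

lemma IsLightCoherent.adj_of_adj_heavy (hstar : G.IsLightCoherent) (hcl : G.HasLightCliques)
    {h w a c : V} (hh : G.IsHeavy h) (hwh : G.Adj w h) (ha : ¬ G.IsHeavy a) (hc : ¬ G.IsHeavy c)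
    (hwa : G.Adj w a) (hwc : G.Adj w c) (hac : a ≠ c) : G.Adj a c := by
  by_contra hnot
  have hha : h ≠ a := fun e => ha (e ▸ hh)
  have hhc : h ≠ c := fun e => hc (e ▸ hh)
  have h1 := hstar w a h c ha hc hac hnot hwa hwc hwh hha hhc
  have h2 := hstar w c h a hc ha hac.symm (fun e => hnot e.symm) hwc hwa hwh hhc hha
  exact hnot (hcl h a c hh ha hc h1.symm h2.symm hac)

/-- Some vertex other than a heavy vertex `h` lies outside a set `Q` of light vertices: otherwise
the neighbours of `h` would form a clique, and so would be heavy themselves. -/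
lemma HasLightCliques.exists_notMem (hcl : G.HasLightCliques) {h : V} (hh : G.IsHeavy h)
    {Q : Set V} (hQ : ∀ y ∈ Q, ¬ G.IsHeavy y) : ∃ z, z ∉ Q ∧ z ≠ h := by
  classical
  by_contra! hall
  have hmem : ∀ z, z ≠ h → z ∈ Q := fun z hz => by
    by_contra hzQ
    exact hz (hall z hzQ)
  obtain ⟨a, ha⟩ : ∃ a, G.Adj h a := by
    by_contra! hno
    have : G.degree h = 0 := by
      rw [← G.card_neighborFinset_eq_degree, Finset.card_eq_zero, Finset.eq_empty_iff_forall_notMem]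
      intro y
      rw [mem_neighborFinset]
      exact hno y
    unfold IsHeavy at hh
    omega
  have hal := hQ a (hmem a ha.ne')
  refine hal ?_
  have hsub : insert h ((G.neighborFinset h).erase a) ⊆ G.neighborFinset a := by
    intro y hy
    rw [Finset.mem_insert, Finset.mem_erase, mem_neighborFinset] at hy
    rw [mem_neighborFinset]
    rcases hy with rfl | ⟨hya, hy⟩
    · exact ha.symm
    · exact hcl h a y hh hal (hQ y (hmem y hy.ne')) ha hy hya.symm
  have := Finset.card_le_card hsub
  rw [Finset.card_insert_of_notMem (by simp), Finset.card_erase_of_mem (by simpa using ha),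
    card_neighborFinset_eq_degree, card_neighborFinset_eq_degree] at this
  unfold IsHeavy at hh ⊢
  omega

/-- A component of the graph induced by the light vertices is the interior of a path between two
heavy vertices. The last conjunct states that the path meets no other component, and no heavy
vertex attached to another component. -/
lemma IsTwoConnected.exists_heavy_path (h2 : G.IsTwoConnected) (hstar : G.IsLightCoherent)
    (hcl : G.HasLightCliques) (hH : ∃ h, G.IsHeavy h) {x : V} (hx : ¬ G.IsHeavy x) :
    ∃ P : List V, P.Nodup ∧ P.IsChain G.Adj ∧ (∀ y ∈ P.head?, G.IsHeavy y) ∧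
      (∀ y ∈ P.getLast?, G.IsHeavy y) ∧ x ∈ P ∧
      (∀ y ∈ P, ∀ z, ¬ G.IsHeavy z → G.Adj y z → z ∈ P) ∧
      ∀ S : Set V, x ∉ S → (∀ y ∈ S, ∀ z, ¬ G.IsHeavy z → G.Adj y z → z ∈ S) →
        ∀ y ∈ P, y ∉ S := by
  classical
  let r : V → V → Prop := fun u v => G.Adj u v ∧ ¬ G.IsHeavy u ∧ ¬ G.IsHeavy v
  have hr : Std.Symm r := ⟨fun u v huv => ⟨huv.1.symm, huv.2.2, huv.2.1⟩⟩
  let Q : Set V := {y | Relation.ReflTransGen r x y}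
  have hxQ : x ∈ Q := Relation.ReflTransGen.refl
  have hQl : ∀ y ∈ Q, ¬ G.IsHeavy y := by
    intro y hy
    rcases Relation.ReflTransGen.cases_tail hy with rfl | ⟨z, -, hz⟩
    · exact hx
    · exact hz.2.2
  have hQc : ∀ y ∈ Q, ∀ z, ¬ G.IsHeavy z → G.Adj y z → z ∈ Q := fun y hy z hz hyz =>
    Relation.ReflTransGen.tail hy ⟨hyz, hQl y hy, hz⟩
  have hQconn : ∀ S : Set V, ∀ a ∈ Q, a ∈ S → (∀ y ∈ S, ∀ z ∈ Q, G.Adj y z → z ∈ S) →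
      ∀ y ∈ Q, y ∈ S := by
    intro S a haQ haS hS y hy
    have hay : Relation.ReflTransGen r a y :=
      ((Relation.ReflTransGen.stdSymm (r := r)).symm _ _ haQ).trans hy
    have key : y ∈ Q ∧ y ∈ S := by
      clear hy
      induction hay with
      | refl => exact ⟨haQ, haS⟩
      | tail _ hbc ih =>
        have := hQc _ ih.1 _ hbc.2.2 hbc.1
        exact ⟨this, hS _ ih.2 _ this hbc.1⟩
    exact key.2
  -- The neighbours outside `Q` of a vertex of `Q` are heavy.
  have hQh : ∀ y ∈ Q, ∀ z, z ∉ Q → G.Adj y z → G.IsHeavy z := by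
    intro y hy z hz hyz
    by_contra hzl
    exact hz (hQc y hy z hzl hyz)
  have hQcl : ∀ y ∈ Q, ∀ z, z ∉ Q → G.Adj y z → ∀ u ∈ Q, ∀ v ∈ Q, G.Adj y u → G.Adj y v →
      u ≠ v → G.Adj u v := fun y hy z hz hyz u hu v hv hyu hyv huv =>
    hstar.adj_of_adj_heavy hcl (hQh y hy z hz hyz) hyz (hQl u hu) (hQl v hv) hyu hyv huv
  obtain ⟨l, u, v, hl1, hl2, hl3, hl4, hl5, hu, hv, huv⟩ : ∃ l : List V, ∃ u v, l.Nodup ∧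
      l.IsChain G.Adj ∧ (∀ y, y ∈ l ↔ y ∈ Q) ∧ (∃ a ∈ l.head?, G.Adj u a) ∧
      (∃ c ∈ l.getLast?, G.Adj c v) ∧ u ∉ Q ∧ v ∉ Q ∧ u ≠ v := by
    by_cases hone : ∀ y ∈ Q, y = x
    · obtain ⟨u, v, huv, hxu, hxv⟩ := h2.exists_two_adj x
      refine ⟨[x], u, v, by simp, by simp, ?_, ⟨x, by simp, hxu.symm⟩, ⟨x, by simp, hxv⟩,
        fun hu => hxu.ne (hone u hu).symm, fun hv => hxv.ne (hone v hv).symm, huv⟩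
      intro y
      rw [List.mem_singleton]
      exact ⟨fun e => e ▸ hxQ, hone y⟩
    · push Not at hone
      obtain ⟨y, hyQ, hyx⟩ := hone
      obtain ⟨h, hh⟩ := hH
      obtain ⟨z, hzQ, hzh⟩ := hcl.exists_notMem hh hQl
      have hhQ : h ∉ Q := fun hhQ => hQl h hhQ hh
      obtain ⟨a, ha, c, hc, u, hu, v, hv, hac, huv, hau, hcv⟩ :=
        h2.exists_disjoint_adj hxQ hyQ hyx.symm hzQ hhQ hzh
      obtain ⟨l, hl1, hl2, hl3, hl4⟩ := exists_isChain_of_simplicial G Q.toFinset a c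
        (by simpa using ha) (by simpa using hc) hac
        (by
          simp only [Set.mem_toFinset]
          intro w _ s hs t _ q hq hsq hnot hws hwq hwt hts htq
          exact hstar w s t q (hQl s hs) (hQl q hq) hsq hnot hws hwq hwt hts htq)
        (by
          simp only [Set.mem_toFinset]
          exact hQcl a ha u hu hau)
        (by
          simp only [Set.mem_toFinset]
          exact hQcl c hc v hv hcv)
        (by
          simp only [Set.mem_toFinset]
          exact fun S haS => hQconn S a ha haS)
      refine ⟨a :: l, u, v, hl1, hl2, ?_, ⟨a, by simp, hau.symm⟩, ⟨c, hl3, hcv⟩, hu, hv, huv⟩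
      intro y
      rw [hl4, Set.mem_toFinset]
  obtain ⟨a, ha, hua⟩ := hl4
  obtain ⟨c, hc, hcv⟩ := hl5
  have haQ : a ∈ Q := (hl3 a).mp (List.mem_of_mem_head? ha)
  have hcQ : c ∈ Q := (hl3 c).mp (List.mem_of_mem_getLast? hc)
  have huh := hQh a haQ u hu hua.symm
  have hvh := hQh c hcQ v hv hcv
  have hmem : ∀ y, y ∈ u :: (l ++ [v]) ↔ y = u ∨ y ∈ Q ∨ y = v := by
    intro y
    simp only [List.mem_cons, List.mem_append, hl3, List.not_mem_nil, or_false]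
  -- A light neighbour of a heavy vertex attached to `Q` lies in `Q`.
  have hatt : ∀ w, G.IsHeavy w → ∀ a ∈ Q, G.Adj w a → ∀ z, ¬ G.IsHeavy z → G.Adj w z → z ∈ Q := by
    intro w hw a haQ hwa z hz hwz
    by_cases haz : a = z
    · exact haz ▸ haQ
    · exact hQc a haQ z hz (hcl w a z hw (hQl a haQ) hz hwa hwz haz)
  refine ⟨u :: (l ++ [v]), ?_, ?_, ?_, ?_, ?_, ?_, ?_⟩
  · rw [List.nodup_cons, List.nodup_append]
    refine ⟨?_, hl1, by simp, ?_⟩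
    · simp only [List.mem_append, hl3, List.mem_singleton, not_or]
      exact ⟨hu, huv⟩
    · intro s hs t ht
      rw [List.mem_singleton] at ht
      rintro rfl
      exact hv (ht ▸ (hl3 _).mp hs)
  · rw [List.isChain_cons]
    constructor
    · intro y hy
      rw [List.head?_append, Option.mem_def.mp ha] at hy
      simp only [Option.some_or, Option.mem_def, Option.some.injEq] at hy
      exact hy ▸ hua
    · refine hl2.append (by simp) ?_
      intro s hs t ht
      rw [Option.mem_def.mp hc] at hs
      simp only [List.head?_cons, Option.mem_def, Option.some.injEq] at hs ht
      exact hs ▸ ht ▸ hcv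
  · intro y hy
    simp only [List.head?_cons, Option.mem_def, Option.some.injEq] at hy
    exact hy ▸ huh
  · intro y hy
    rw [← List.cons_append, List.getLast?_concat] at hy
    simp only [Option.mem_def, Option.some.injEq] at hy
    exact hy ▸ hvh
  · exact (hmem x).mpr (Or.inr (Or.inl hxQ))
  · intro y hy z hz hyz
    refine (hmem z).mpr (Or.inr (Or.inl ?_))
    rcases (hmem y).mp hy with rfl | hyQ | rfl
    · exact hatt _ huh a haQ hua z hz hyz
    · exact hQc y hyQ z hz hyz
    · exact hatt _ hvh c hcQ hcv.symm z hz hyz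
  · intro S hxS hS y hy hyS
    have key : ∀ w ∈ Q, w ∉ S := fun w hwQ hwS => hxS
      (hQconn S w hwQ hwS (fun y hy z hz hyz => hS y hy z (hQl z hz) hyz) x hxQ)
    rcases (hmem y).mp hy with rfl | hyQ | rfl
    · exact key a haQ (hS _ hyS a (hQl a haQ) hua)
    · exact key y hyQ hyS
    · exact key c hcQ (hS _ hyS c (hQl c hcQ) hcv.symm)

/-- `G` together with all edges between heavy vertices. -/
def heavyClosure (G : SimpleGraph V) [DecidableRel G.Adj] : SimpleGraph V :=
  G ⊔ SimpleGraph.fromRel fun x y => G.IsHeavy x ∧ G.IsHeavy y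

lemma heavyClosure_adj {x y : V} :
    G.heavyClosure.Adj x y ↔ G.Adj x y ∨ x ≠ y ∧ G.IsHeavy x ∧ G.IsHeavy y := by
  simp only [heavyClosure, sup_adj, fromRel_adj]
  tauto

lemma IsTwoConnected.exists_isHamOrder_heavyClosure (h2 : G.IsTwoConnected)
    (hstar : G.IsLightCoherent) (hcl : G.HasLightCliques) (hH : ∃ h, G.IsHeavy h) :
    ∃ g, G.heavyClosure.IsHamOrder g := by
  classical
  -- A longest path of the closure with heavy ends that contains all light neighbours of its
  -- vertices is Hamiltonian, as the path through a further component could be appended to it.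
  let good : List V → Prop := fun l => l.Nodup ∧ l.IsChain G.heavyClosure.Adj ∧
    (∀ y ∈ l.head?, G.IsHeavy y) ∧ (∀ y ∈ l.getLast?, G.IsHeavy y) ∧
    ∀ y ∈ l, ∀ z, ¬ G.IsHeavy z → G.Adj y z → z ∈ l
  let p : ℕ → Prop := fun m => ∃ l, good l ∧ l.length = m
  have hp0 : p 0 := ⟨[], ⟨by simp, by simp, by simp, by simp, by simp⟩, rfl⟩
  have hbound : ∀ m, p m → m ≤ Fintype.card V := by
    rintro m ⟨l, hl, rfl⟩
    exact hl.1.length_le_card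
  obtain ⟨l, ⟨hl1, hl2, hl3, hl4, hl5⟩, hlen⟩ := Nat.findGreatest_spec (P := p) (Nat.zero_le _) hp0
  have hmax : ∀ P : List V, P.Nodup → P.IsChain G.heavyClosure.Adj →
      (∀ y ∈ P.head?, G.IsHeavy y) → (∀ y ∈ P.getLast?, G.IsHeavy y) →
      (∀ y ∈ P, ∀ z, ¬ G.IsHeavy z → G.Adj y z → z ∈ l ∨ z ∈ P) → P ≠ [] →
      (∀ y ∈ P, y ∉ l) → False := by
    intro P hP1 hP2 hP3 hP4 hP5 hne hdisj
    have hgood : good (l ++ P) := by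
      refine ⟨?_, ?_, ?_, ?_, ?_⟩
      · rw [List.nodup_append]
        exact ⟨hl1, hP1, fun a ha b hb e => hdisj b hb (e ▸ ha)⟩
      · refine hl2.append hP2 fun a ha b hb => heavyClosure_adj.mpr (Or.inr ?_)
        refine ⟨?_, hl4 a ha, hP3 b hb⟩
        rintro rfl
        exact hdisj _ (List.mem_of_mem_head? hb) (List.mem_of_mem_getLast? ha)
      · intro y hy
        rw [List.head?_append] at hy
        cases hl : l.head? with
        | none => rw [hl] at hy; exact hP3 y hy
        | some t => rw [hl] at hy; exact hl3 y (by rw [hl]; exact hy)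
      · intro y hy
        rw [List.getLast?_append_of_ne_nil _ hne] at hy
        exact hP4 y hy
      · intro y hy z hz hyz
        rw [List.mem_append] at hy ⊢
        exact hy.elim (fun h => Or.inl (hl5 y h z hz hyz)) (fun h => hP5 y h z hz hyz)
    have hle := Nat.le_findGreatest (P := p) (hbound _ ⟨_, hgood, rfl⟩) ⟨_, hgood, rfl⟩
    rw [← hlen, List.length_append] at hle
    exact hne (List.length_eq_zero_iff.mp (by omega))
  have hlight : ∀ x, ¬ G.IsHeavy x → x ∈ l := by
    intro x hx
    by_contra hxl
    obtain ⟨P, hP1, hP2, hP3, hP4, hP5, hP6, hP7⟩ := h2.exists_heavy_path hstar hcl hH hx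
    refine hmax P hP1 (hP2.imp fun a b hab => heavyClosure_adj.mpr (Or.inl hab)) hP3 hP4
      (fun y hy z hz hyz => Or.inr (hP6 y hy z hz hyz)) (List.ne_nil_of_mem hP5) ?_
    exact hP7 {y | y ∈ l} hxl hl5
  have hall : ∀ x, x ∈ l := by
    intro x
    by_cases hx : G.IsHeavy x
    · by_contra hxl
      exact hmax [x] (by simp) (by simp) (by simpa using hx) (by simpa using hx)
        (fun y _ z hz _ => Or.inl (hlight z hz)) (by simp) (by simpa using hxl)
    · exact hlight x hx
  exact IsHamOrder.exists_of_list h2.1 hl1 hall hl2 fun a ha b hb hab =>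
    heavyClosure_adj.mpr (Or.inr ⟨hab.symm, hl4 b hb, hl3 a ha⟩)

lemma IsTwoConnected.exists_isHamOrder (h2 : G.IsTwoConnected)
    (hstar : G.IsLightCoherent) (hcl : G.HasLightCliques) (hH : ∃ h, G.IsHeavy h) :
    ∃ g, G.IsHamOrder g := by
  obtain ⟨g, hg⟩ := h2.exists_isHamOrder_heavyClosure hstar hcl hH
  refine hg.exists_of_degree_add h2.1 le_sup_left ?_
  intro u v huv hnot
  have := (heavyClosure_adj.mp huv).resolve_left hnot
  unfold IsHeavy at this
  omega

end

/-! ### Consecutive heavy vertices on a Hamiltonian cycle -/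

section

variable {V : Type*} [Fintype V] {G : SimpleGraph V} [DecidableRel G.Adj]

lemma IsHamOrder.isPancyclic_of_isHeavy {g : ℕ → V} (hg : G.IsHamOrder g) {i : ℕ}
    (h0 : G.IsHeavy (g i)) (h1 : G.IsHeavy (g (i + 1))) : G.IsPancyclic := by
  have hpos : 0 < Fintype.card V := Fintype.card_pos_iff.mpr ⟨g 0⟩
  refine (hg.shift (i + 1)).isPancyclic_of_degree_add ?_
  rw [show Fintype.card V - 1 + (i + 1) = i + Fintype.card V by omega, hg.add_card, zero_add]
  unfold IsHeavy at h0 h1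
  omega

/-- Suppose that no two consecutive vertices of a Hamiltonian cycle are heavy. Following the cycle
shows that the light vertices form a clique. There are at least as many light vertices as heavy
ones, so that a light vertex, having degree at most `n / 2`, has at most one heavy neighbour;
but each heavy vertex has two light neighbours on the cycle. -/
lemma IsHamOrder.exists_consecutive_isHeavy {g : ℕ → V} (hg : G.IsHamOrder g)
    (hn : 3 ≤ Fintype.card V) (hstar : G.IsLightCoherent) (hcl : G.HasLightCliques)
    (hH : ∃ h, G.IsHeavy h) : ∃ i, G.IsHeavy (g i) ∧ G.IsHeavy (g (i + 1)) := by
  classical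
  by_contra! hno
  obtain ⟨h, hh⟩ := hH
  obtain ⟨s, -, rfl⟩ := hg.exists_lt h
  wlog hs : s = 0 generalizing g s
  · exact this (hg.shift s) (fun i hi => by
      have := hno (i + s) hi
      rwa [show i + s + 1 = i + 1 + s by ring] at this) 0 (by simpa using hh) rfl
  subst hs
  have hgn : g (Fintype.card V - 1 + 1) = g 0 := by
    rw [Nat.sub_add_cancel (by omega)]
    simpa using hg.add_card 0
  set a := g 1 with hadef
  set c := g (Fintype.card V - 1) with hcdef
  have h0a : G.Adj (g 0) a := hg.1 0
  have h0c : G.Adj (g 0) c := by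
    have := hg.1 (Fintype.card V - 1)
    rw [hgn] at this
    exact this.symm
  have hal : ¬ G.IsHeavy a := hno 0 hh
  have hclt : ¬ G.IsHeavy c := fun hc => hno _ hc (hgn ▸ hh)
  have hac : a ≠ c := by
    intro e
    have := hg.inj _ (by omega) _ (by omega) e
    omega
  have hacadj : G.Adj a c := hcl _ a c hh hal hclt h0a h0c hac
  -- The light vertices in the closed neighbourhood of `a` are closed under light adjacency.
  have hclosed : ∀ z, ¬ G.IsHeavy z → (z = a ∨ G.Adj a z) → ∀ y, ¬ G.IsHeavy y → G.Adj z y →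
      y = a ∨ G.Adj a y := by
    rintro z hz (rfl | haz) y hy hzy
    · exact Or.inr hzy
    by_contra! hnot
    have hcy : G.Adj c y := by
      by_cases hzc : z = c
      · exact hzc ▸ hzy
      · have hzc' : G.Adj z c :=
          hstar.adj_of_adj_heavy hcl hh h0a.symm hz hclt haz hacadj hzc
        exact (hstar z y c a hy hal hnot.1 (fun e => hnot.2 e.symm) hzy haz.symm hzc'
          (fun e => hnot.2 (e ▸ hacadj)) hac.symm).symm
    exact hnot.2 (hstar.adj_of_adj_heavy hcl hh h0c.symm hal hy hacadj.symm hcy hnot.1.symm)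
  -- Along the cycle, consecutive light vertices are adjacent, and so are light vertices on both
  -- sides of a heavy one.
  have hseq : ∀ i, (¬ G.IsHeavy (g (i + 1)) → g (i + 1) = a ∨ G.Adj a (g (i + 1))) ∧
      (¬ G.IsHeavy (g (i + 2)) → g (i + 2) = a ∨ G.Adj a (g (i + 2))) := by
    intro i
    induction i with
    | zero => exact ⟨fun _ => Or.inl rfl, fun _ => Or.inr (hg.1 1)⟩
    | succ i ih =>
      refine ⟨ih.2, fun hl => ?_⟩
      by_cases hm : G.IsHeavy (g (i + 2))
      · have hl' : ¬ G.IsHeavy (g (i + 1)) := fun e => hno (i + 1) e hm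
        by_cases he : g (i + 1) = g (i + 1 + 2)
        · exact he ▸ ih.1 hl'
        · exact hclosed _ hl' (ih.1 hl') _ hl
            (hcl _ _ _ hm hl' hl (hg.1 (i + 1)).symm (hg.1 (i + 2)) he)
      · exact hclosed _ hm (ih.2 hm) _ hl (hg.1 (i + 2))
  have hLa : ∀ x, ¬ G.IsHeavy x → x = a ∨ G.Adj a x := by
    intro x hx
    obtain ⟨i, -, rfl⟩ := hg.exists_lt x
    have := (hseq (i + Fintype.card V - 1)).1
    rw [Nat.sub_add_cancel (by omega), hg.add_card] at this
    exact this hx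
  have hLcl : ∀ x y, ¬ G.IsHeavy x → ¬ G.IsHeavy y → x ≠ y → G.Adj x y := by
    intro x y hx hy hxy
    rcases hLa x hx with rfl | hx'
    · exact (hLa y hy).resolve_left (Ne.symm hxy)
    · rcases hLa y hy with rfl | hy'
      · exact hx'.symm
      · exact hstar.adj_of_adj_heavy hcl hh h0a.symm hx hy hx' hy' hxy
  let H := Finset.univ.filter fun x => G.IsHeavy x
  let L := Finset.univ.filter fun x => ¬ G.IsHeavy x
  have hHL : H.card + L.card = Fintype.card V :=
    Finset.card_filter_add_card_filter_not (s := Finset.univ) fun x => G.IsHeavy x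
  have hHle : H.card ≤ L.card := by
    choose idx hidx hgidx using hg.exists_lt
    refine Finset.card_le_card_of_injOn (fun x => g (idx x + 1)) ?_ ?_
    · intro x hx
      simp only [Finset.coe_filter, Finset.mem_univ, true_and, Set.mem_ofPred_eq, H, L] at hx ⊢
      exact hno _ (by rwa [hgidx])
    · intro x _ y _ hxy
      have := Nat.ModEq.add_right_cancel' 1 ((hg.2 _ _).mp hxy)
      rw [← hgidx x, ← hgidx y]
      exact (hg.2 _ _).mpr this
  have hdegL : ∀ x, ¬ G.IsHeavy x →
      L.card - 1 + (H.filter fun y => G.Adj y x).card ≤ G.degree x := by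
    intro x hx
    rw [← Finset.card_erase_of_mem (s := L) (a := x) (by simpa [L] using hx),
      ← Finset.card_union_of_disjoint, ← G.card_neighborFinset_eq_degree]
    · refine Finset.card_le_card fun y hy => ?_
      rw [mem_neighborFinset]
      simp only [Finset.mem_union, Finset.mem_erase, Finset.mem_filter, L, H, Finset.mem_univ,
        true_and] at hy
      rcases hy with hy | hy
      · exact hLcl x y hx hy.2 hy.1.symm
      · exact hy.2.symm
    · rw [Finset.disjoint_left]
      intro y hy hy'
      simp only [Finset.mem_erase, Finset.mem_filter, L, H, Finset.mem_univ, true_and] at hy hy'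
      exact hy.2 hy'.1
  have hHpos : 0 < H.card := Finset.card_pos.mpr ⟨g 0, by simpa [H] using hh⟩
  have hdouble : H.card * 2 ≤ L.card * 1 := by
    refine Finset.card_mul_le_card_mul G.Adj ?_ ?_
    · intro x hx
      simp only [Finset.mem_filter, Finset.mem_univ, true_and, H] at hx
      obtain ⟨i, rfl⟩ : ∃ i, x = g (i + 1) := by
        obtain ⟨i, -, rfl⟩ := hg.exists_lt x
        refine ⟨i + Fintype.card V - 1, ?_⟩
        rw [Nat.sub_add_cancel (by omega), hg.add_card]
      rw [← Finset.card_pair (hg.ne_add_two hn i)]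
      refine Finset.card_le_card fun y hy => ?_
      simp only [Finset.mem_insert, Finset.mem_singleton] at hy
      simp only [Finset.mem_bipartiteAbove, L, Finset.mem_filter, Finset.mem_univ, true_and]
      rcases hy with rfl | rfl
      · exact ⟨fun e => hno i e hx, (hg.1 i).symm⟩
      · exact ⟨hno _ hx, hg.1 (i + 1)⟩
    · intro x hx
      simp only [Finset.mem_filter, Finset.mem_univ, true_and, L] at hx
      have h1 := hdegL x hx
      unfold IsHeavy at hx
      change (H.filter fun y => G.Adj y x).card ≤ 1
      omega
  have h1 := hdegL a hal
  have h2 : 0 < (H.filter fun y => G.Adj y a).card :=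
    Finset.card_pos.mpr ⟨g 0, by simpa [H] using ⟨hh, h0a⟩⟩
  unfold IsHeavy at hal
  omega

end

/-! ### A heavy vertex with nonadjacent light neighbours -/

section

variable {V : Type*} [Fintype V] {G : SimpleGraph V} [DecidableRel G.Adj]

/-- If a heavy vertex has two nonadjacent light neighbours, then the graph is `K₄` without an
edge. -/
lemma IsLightCoherent.isPancyclic_of_not_adj (hstar : G.IsLightCoherent) (h2 : G.IsTwoConnected)
    {h a c : V} (hh : G.IsHeavy h) (ha : ¬ G.IsHeavy a) (hc : ¬ G.IsHeavy c) (hha : G.Adj h a)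
    (hhc : G.Adj h c) (hac : a ≠ c) (hnot : ¬ G.Adj a c) : G.IsPancyclic := by
  classical
  let M := G.neighborFinset a ∩ G.neighborFinset c
  have hM : ∀ {y}, y ∈ M ↔ G.Adj a y ∧ G.Adj c y := by
    intro y
    simp [M]
  have hhM : h ∈ M := hM.mpr ⟨hha.symm, hhc.symm⟩
  have hclosed : ∀ w ∈ M, ∀ b, G.Adj w b → b ≠ a → b ≠ c → b ∈ M := by
    intro w hw b hwb hba hbc
    obtain ⟨h1, h2⟩ := hM.mp hw
    exact hM.mpr ⟨hstar w a b c ha hc hac hnot h1.symm h2.symm hwb hba hbc,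
      hstar w c b a hc ha hac.symm (fun e => hnot e.symm) h2.symm h1.symm hwb hbc hba⟩
  -- As `a` and `c` are light, `M` is so large that it contains all their neighbours; it then
  -- makes up the whole graph together with `a` and `c`.
  have hcardM : G.degree h ≤ M.card + 1 := by
    have hsub : insert h (((G.neighborFinset h).erase a).erase c) ⊆ M := by
      intro y hy
      simp only [Finset.mem_insert, Finset.mem_erase, mem_neighborFinset] at hy
      rcases hy with rfl | hy
      · exact hhM
      · exact hclosed h hhM y hy.2.2 hy.2.1 hy.1
    have := Finset.card_le_card hsub
    rw [Finset.card_insert_of_notMem (by simp), Finset.card_erase_of_mem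
      (by simpa using ⟨hac.symm, hhc⟩), Finset.card_erase_of_mem (by simpa using hha),
      card_neighborFinset_eq_degree] at this
    omega
  have hMa : M = G.neighborFinset a := by
    refine Finset.eq_of_subset_of_card_le Finset.inter_subset_left ?_
    rw [card_neighborFinset_eq_degree]
    unfold IsHeavy at hh ha
    omega
  have hMc : M = G.neighborFinset c := by
    refine Finset.eq_of_subset_of_card_le Finset.inter_subset_right ?_
    rw [card_neighborFinset_eq_degree]
    unfold IsHeavy at hh hc
    omega
  have haM : a ∉ M := fun e => G.irrefl (hM.mp e).1
  have hcM : c ∉ M := fun e => hnot (hM.mp e).1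
  have huniv : ∀ x, x ∈ insert a (insert c M) := by
    by_contra! hx
    obtain ⟨x, hx⟩ := hx
    obtain ⟨u, hu, v, hv, huv⟩ := h2.2.1.exists_adj_boundary
      (S := (insert a (insert c M) : Finset V)) (y := a) (z := x) (by simp) (by simpa using hx)
    simp only [Finset.coe_insert, Set.mem_insert_iff, Finset.mem_coe, not_or] at hu hv
    rcases hu with rfl | rfl | hu
    · exact hv.2.2 (by rw [hMa, mem_neighborFinset]; exact huv)
    · exact hv.2.2 (by rw [hMc, mem_neighborFinset]; exact huv)
    · exact hv.2.2 (hclosed u hu v huv hv.1 hv.2.1)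
  have hcard : Fintype.card V = M.card + 2 := by
    rw [← Finset.card_univ, ← Finset.eq_univ_of_forall huniv, Finset.card_insert_of_notMem,
      Finset.card_insert_of_notMem hcM]
    simp [haM, hac]
  have hdega : G.degree a = M.card := by rw [hMa, card_neighborFinset_eq_degree]
  have hdegc : G.degree c = M.card := by rw [hMc, card_neighborFinset_eq_degree]
  obtain ⟨m, hmh, ham⟩ := h2.exists_adj_ne hha.ne'
  have hmM : m ∈ M := by rwa [hMa, mem_neighborFinset]
  have hM2 : 2 ≤ M.card := by
    rw [← Finset.card_pair hmh]
    refine Finset.card_le_card fun y hy => ?_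
    simp only [Finset.mem_insert, Finset.mem_singleton] at hy
    rcases hy with rfl | rfl
    · exact hmM
    · exact hhM
  have hcm : G.Adj c m := (hM.mp hmM).2
  obtain ⟨g, hg, hg0, hg3⟩ : ∃ g, G.IsHamOrder g ∧ g 0 = h ∧ g (Fintype.card V - 1) = c := by
    have h4 : Fintype.card V = 4 := by
      unfold IsHeavy at ha
      omega
    let f : ℕ → V := fun i => if i = 0 then h else if i = 1 then a else if i = 2 then m else c
    refine ⟨_, IsHamOrder.of_injOn f ?_ ?_ ?_, ?_, ?_⟩
    · rw [h4]
      intro i hi j hj hij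
      interval_cases i <;> interval_cases j <;> first
        | rfl
        | exact absurd hij (by simp [f, hmh, hmh.symm, hha.ne, hha.ne', hhc.ne, hhc.ne', ham.ne,
            ham.ne', hcm.ne, hcm.ne', hac, hac.symm])
    · rw [h4]
      intro i hi
      have hi : i < 3 := by omega
      interval_cases i
      · exact hha
      · exact ham
      · exact hcm.symm
    · rw [h4]
      exact hhc.symm
    · simp [f]
    · simp [h4, f]
  refine hg.isPancyclic_of_degree_add ?_
  rw [hg0, hg3]
  unfold IsHeavy at hh
  omega

end

/-! ### Graphs without heavy vertices -/

section

variable {V : Type*} [Fintype V] {G : SimpleGraph V} [DecidableRel G.Adj]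

/-- Without heavy vertices, two nonadjacent neighbours of a vertex of degree at least three have the
same neighbours. -/
lemma IsLightCoherent.adj_of_adj (hstar : G.IsLightCoherent) (hL : ∀ x, ¬ G.IsHeavy x)
    {w a b c y : V} (hac : a ≠ c) (hnot : ¬ G.Adj a c) (hwa : G.Adj w a) (hwc : G.Adj w c)
    (hwb : G.Adj w b) (hba : b ≠ a) (hbc : b ≠ c) (hay : G.Adj a y) : G.Adj c y := by
  by_contra hcy
  have hst : ∀ w a b c, a ≠ c → ¬ G.Adj a c → G.Adj w a → G.Adj w c → G.Adj w b → b ≠ a → b ≠ c →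
      G.Adj a b := fun w a b c => hstar w a b c (hL a) (hL c)
  have hab := hst w a b c hac hnot hwa hwc hwb hba hbc
  have hcb := hst w c b a hac.symm (fun e => hnot e.symm) hwc hwa hwb hbc hba
  have hyc : y ≠ c := fun e => hnot (e ▸ hay)
  have hyw : ¬ G.Adj y w := fun e =>
    hcy (hst w c y a hac.symm (fun e => hnot e.symm) hwc hwa e.symm hyc hay.ne')
  have hyb := hst a y b w (fun e => hcy (e ▸ hwc.symm)) hyw hay hwa.symm hab
    (fun e => hcy (e ▸ hcb)) hwb.ne'
  exact hcy (hst b c y a hac.symm (fun e => hnot e.symm) hcb.symm hab.symm hyb.symm hyc hay.ne')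

/-- Without heavy vertices, two nonadjacent neighbours `a` and `c` of a vertex of degree at least
three would have all other vertices as neighbours, hence degree `n - 2`, which is too large. -/
lemma IsLightCoherent.not_exists_third_adj (hstar : G.IsLightCoherent) (hconn : G.Connected)
    (hL : ∀ x, ¬ G.IsHeavy x) {w a b c : V} (hac : a ≠ c) (hnot : ¬ G.Adj a c) (hwa : G.Adj w a)
    (hwc : G.Adj w c) (hba : b ≠ a) (hbc : b ≠ c) : ¬ G.Adj w b := by
  classical
  intro hwb
  have hNac : ∀ y, G.Adj a y → G.Adj c y := fun y =>
    hstar.adj_of_adj hL hac hnot hwa hwc hwb hba hbc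
  have hNca : ∀ y, G.Adj c y → G.Adj a y := fun y =>
    hstar.adj_of_adj hL hac.symm (fun e => hnot e.symm) hwc hwa hwb hbc hba
  have huniv : ∀ x, x ∈ insert a (insert c (G.neighborFinset a)) := by
    by_contra! hx
    obtain ⟨x, hx⟩ := hx
    obtain ⟨u, hu, v, hv, huv⟩ := hconn.exists_adj_boundary
      (S := (insert a (insert c (G.neighborFinset a)) : Finset V)) (y := a) (z := x)
      (by simp) (by simpa using hx)
    simp only [Finset.coe_insert, Set.mem_insert_iff, Finset.mem_coe, not_or,
      mem_neighborFinset] at hu hv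
    rcases hu with rfl | rfl | hu
    · exact hv.2.2 huv
    · exact hv.2.2 (hNca v huv)
    · exact hv.2.2 (hstar u a v c (hL a) (hL c) hac hnot hu.symm (hNac u hu).symm huv hv.1 hv.2.1)
  have hcard : Fintype.card V = G.degree a + 2 := by
    rw [← Finset.card_univ, ← Finset.eq_univ_of_forall huniv, Finset.card_insert_of_notMem,
      Finset.card_insert_of_notMem, card_neighborFinset_eq_degree]
    · simpa using hnot
    · simp [hac]
  have hw3 : 3 ≤ G.degree w := by
    rw [← card_neighborFinset_eq_degree,
      ← Finset.card_eq_three.mpr ⟨a, b, c, hba.symm, hac, hbc, rfl⟩]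
    refine Finset.card_le_card fun y hy => ?_
    simp only [Finset.mem_insert, Finset.mem_singleton] at hy
    rw [mem_neighborFinset]
    rcases hy with rfl | rfl | rfl <;> assumption
  have h1 := hL a
  have h2 := hL w
  unfold IsHeavy at h1 h2
  omega

lemma IsLightCoherent.degree_le_two (hstar : G.IsLightCoherent) (hconn : G.Connected)
    (hL : ∀ x, ¬ G.IsHeavy x) (w : V) : G.degree w ≤ 2 := by
  classical
  by_contra! hw
  have hthird : ∀ s t, ∃ b, G.Adj w b ∧ b ≠ s ∧ b ≠ t := by
    intro s t
    have : ({s, t} : Finset V).card < (G.neighborFinset w).card := by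
      rw [card_neighborFinset_eq_degree]
      exact lt_of_le_of_lt Finset.card_le_two hw
    obtain ⟨b, hb, hb'⟩ := Finset.exists_mem_notMem_of_card_lt_card this
    simp only [Finset.mem_insert, Finset.mem_singleton, not_or] at hb'
    exact ⟨b, by simpa using hb, hb'⟩
  have hclique : ∀ a c, G.Adj w a → G.Adj w c → a ≠ c → G.Adj a c := by
    intro a c hwa hwc hac
    by_contra hnot
    obtain ⟨b, hwb, hba, hbc⟩ := hthird a c
    exact hstar.not_exists_third_adj hconn hL hac hnot hwa hwc hba hbc hwb
  have huniv : ∀ x, x ∈ insert w (G.neighborFinset w) := by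
    by_contra! hx
    obtain ⟨x, hx⟩ := hx
    obtain ⟨u, hu, v, hv, huv⟩ := hconn.exists_adj_boundary
      (S := (insert w (G.neighborFinset w) : Finset V)) (y := w) (z := x)
      (by simp) (by simpa using hx)
    simp only [Finset.coe_insert, Set.mem_insert_iff, Finset.mem_coe, not_or,
      mem_neighborFinset] at hu hv
    rcases hu with rfl | hu
    · exact hv.2 huv
    · obtain ⟨t, hwt, htu, htv⟩ := hthird u v
      exact hstar.not_exists_third_adj hconn hL (Ne.symm hv.1) hv.2 hu.symm huv hwt.ne' htv
        (hclique u t hu hwt htu.symm)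
  have hcard : Fintype.card V = G.degree w + 1 := by
    rw [← Finset.card_univ, ← Finset.eq_univ_of_forall huniv,
      Finset.card_insert_of_notMem (by simp), card_neighborFinset_eq_degree]
  have := hL w
  unfold IsHeavy at this
  omega

lemma IsTwoConnected.isCycleGraph_of_not_isHeavy (h2 : G.IsTwoConnected)
    (hstar : G.IsLightCoherent) (hL : ∀ x, ¬ G.IsHeavy x) : G.IsCycleGraph := by
  classical
  have hdeg := hstar.degree_le_two h2.2.1 hL
  obtain ⟨x⟩ : Nonempty V := h2.2.1.nonempty
  obtain ⟨a, c, hac, hxa, hxc⟩ := h2.exists_two_adj x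
  -- A neighbour of `x` has at most one further neighbour, so it is simplicial in `V \ {x}`.
  have hsimp : ∀ d, G.Adj x d → ∀ s ∈ Finset.univ.erase x, ∀ t ∈ Finset.univ.erase x,
      G.Adj d s → G.Adj d t → s ≠ t → G.Adj s t := by
    intro d hxd s hs t ht hds hdt hst
    have hsub : ({x, s, t} : Finset V) ⊆ G.neighborFinset d := by
      intro z hz
      simp only [Finset.mem_insert, Finset.mem_singleton] at hz
      rw [mem_neighborFinset]
      rcases hz with rfl | rfl | rfl
      · exact hxd.symm
      · exact hds
      · exact hdt
    have h1 := Finset.card_le_card hsub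
    rw [Finset.card_eq_three.mpr ⟨x, s, t, (Finset.ne_of_mem_erase hs).symm,
      (Finset.ne_of_mem_erase ht).symm, hst, rfl⟩, card_neighborFinset_eq_degree] at h1
    have := hdeg d
    omega
  obtain ⟨l, hl1, hl2, hl3, hl4⟩ := exists_isChain_of_simplicial G (Finset.univ.erase x) a c
    (by simpa using hxa.ne') (by simpa using hxc.ne') hac
    (fun w _ s _ t _ q _ hsq hnot hws hwq hwt hts htq =>
      hstar w s t q (hL s) (hL q) hsq hnot hws hwq hwt hts htq)
    (hsimp a hxa) (hsimp c hxc)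
    (by
      intro S haS hS y hy
      by_contra hyS
      obtain ⟨u, hu, v, hv, -, hvx, huv⟩ :=
        h2.exists_adj_boundary x haS hyS hxa.ne' (Finset.ne_of_mem_erase hy)
      exact hv (hS u hu v (by simpa using hvx) huv))
  obtain ⟨g, hg⟩ := IsHamOrder.exists_of_list (F := G) h2.1 (l := x :: a :: l)
    (List.nodup_cons.mpr ⟨fun hx => by simpa using (hl4 x).mp hx, hl1⟩)
    (fun y => by
      rw [List.mem_cons, hl4]
      by_cases hy : y = x
      · exact Or.inl hy
      · exact Or.inr (by simpa using hy))
    (List.isChain_cons_cons.mpr ⟨hxa, hl2⟩)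
    (by
      intro s hs t ht _
      rw [List.getLast?_cons_cons, hl3] at ht
      simp only [List.head?_cons, Option.mem_def, Option.some.injEq] at hs ht
      exact hs ▸ ht ▸ hxc.symm)
  exact hg.isCycleGraph h2.1 hdeg

end

/-! ### Induced claws and triangles with a pendant edge -/

section

variable {V : Type*} [Fintype V] {G : SimpleGraph V} [DecidableRel G.Adj]

lemma dist_eq_two {W : Type*} {K : SimpleGraph W} {u v w : W} (huv : u ≠ v) (hnot : ¬ K.Adj u v)
    (huw : K.Adj u w) (hwv : K.Adj w v) : K.dist u v = 2 := by
  have hle : K.dist u v ≤ 2 := dist_le (Walk.cons huw (Walk.cons hwv Walk.nil))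
  have hr : K.Reachable u v := huw.reachable.trans hwv.reachable
  have h0 : K.dist u v ≠ 0 := fun h => huv (hr.dist_eq_zero_iff.mp h)
  have h1 : K.dist u v ≠ 1 := fun h => hnot (dist_eq_one_iff_adj.mp h)
  omega

/-- The heaviness condition for an induced copy of `R` given as an embedding. -/
lemma IsFHeavy.isHeavy_or {W : Type*} {R : SimpleGraph W} (hR : G.IsFHeavy R 1) (e : R ↪g G)
    {u v w : W} (huv : u ≠ v) (hnot : ¬ R.Adj u v) (huw : R.Adj u w) (hwv : R.Adj w v) :
    G.IsHeavy (e u) ∨ G.IsHeavy (e v) := by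
  have := hR (Set.range e) ⟨e.isoInduceRange.symm⟩ ⟨e u, u, rfl⟩ ⟨e v, v, rfl⟩
    (dist_eq_two (w := ⟨e w, w, rfl⟩) (by simpa [Subtype.ext_iff] using huv) (by simpa using hnot)
      (by simpa using huw) (by simpa using hwv))
  unfold IsHeavy
  rw [div_le_iff₀ (by norm_num), max_mul_of_nonneg _ _ (by norm_num), le_max_iff] at this
  refine this.imp (fun h => ?_) (fun h => ?_)
  all_goals
    rw [mul_comm]
    exact_mod_cast h

lemma IsFHeavy.isHeavy_or_of_claw (hclaw : G.IsFHeavy claw 1) {w a b c : V} (hwa : G.Adj w a)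
    (hwb : G.Adj w b) (hwc : G.Adj w c) (hab : a ≠ b) (hac : a ≠ c) (hbc : b ≠ c)
    (nab : ¬ G.Adj a b) (nac : ¬ G.Adj a c) (nbc : ¬ G.Adj b c) :
    G.IsHeavy a ∨ G.IsHeavy c := by
  let f : Fin 1 ⊕ Fin 3 → V := Sum.elim (fun _ => w) ![a, b, c]
  have hf : Function.Injective f := by
    have := hwa.ne
    have := hwb.ne
    have := hwc.ne
    rintro (i | i) (j | j) hij <;> fin_cases i <;> fin_cases j <;> simp_all [f]
  let e : claw ↪g G := ⟨⟨f, hf⟩, by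
    have nba : ¬ G.Adj b a := fun h => nab h.symm
    have nca : ¬ G.Adj c a := fun h => nac h.symm
    have ncb : ¬ G.Adj c b := fun h => nbc h.symm
    rintro (i | i) (j | j) <;> fin_cases i <;> fin_cases j <;>
      simp_all [f, completeBipartiteGraph, G.adj_comm]⟩
  exact hclaw.isHeavy_or e (u := Sum.inr 0) (v := Sum.inr 2) (w := Sum.inl 0) (by decide)
    (by simp) (by simp) (by simp)

lemma IsFHeavy.isHeavy_or_of_zGraph (hZ : G.IsFHeavy (zGraph 1) 1) {w a b c : V} (hab : G.Adj a b)
    (hwa : G.Adj w a) (hwb : G.Adj w b) (hwc : G.Adj w c) (hac : a ≠ c) (hbc : b ≠ c)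
    (nac : ¬ G.Adj a c) (nbc : ¬ G.Adj b c) : G.IsHeavy a ∨ G.IsHeavy c := by
  let f : Fin 4 → V := ![a, b, w, c]
  have hf : Function.Injective f := by
    have := hwa.ne
    have := hwb.ne
    have := hwc.ne
    have := hab.ne
    intro i j hij
    fin_cases i <;> fin_cases j <;> simp_all [f]
  have hadj : ∀ i j : Fin 4, (zGraph 1).Adj i j ↔
      (i.val + 1 = j.val ∨ j.val + 1 = i.val) ∨ ((i = 0 ∧ j = 2 ∨ i = 2 ∧ j = 0) ∧ i ≠ j) := by
    intro i j
    simp only [zGraph, sup_adj, pathGraph_adj, edge_adj]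
  let e : zGraph 1 ↪g G := ⟨⟨f, hf⟩, by
    have hba := hab.symm
    have haw := hwa.symm
    have hbw := hwb.symm
    have hcw := hwc.symm
    have nca : ¬ G.Adj c a := fun h => nac h.symm
    have ncb : ¬ G.Adj c b := fun h => nbc h.symm
    intro i j
    rw [hadj]
    fin_cases i <;> fin_cases j <;> simp_all [f]⟩
  exact hZ.isHeavy_or e (u := 0) (v := 3) (w := 2) (by decide)
    (by rw [hadj]; decide) (by rw [hadj]; decide) (by rw [hadj]; decide)

/-- With two light vertices among them, `w, a, b, c` induce neither a claw nor a triangle with a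
pendant edge. -/
lemma isLightCoherent_of_isFHeavy (hclaw : G.IsFHeavy claw 1) (hZ : G.IsFHeavy (zGraph 1) 1) :
    G.IsLightCoherent := by
  intro w a b c ha hc hac hnot hwa hwc hwb hba hbc
  by_contra hab
  by_cases hcb : G.Adj c b
  · exact (hZ.isHeavy_or_of_zGraph hcb hwc hwb hwa hac.symm hba (fun e => hnot e.symm)
      (fun e => hab e.symm)).elim hc ha
  · exact (hclaw.isHeavy_or_of_claw hwa hwb hwc hba.symm hac hbc hab hnot
      (fun e => hcb e.symm)).elim ha hc

end

end SimpleGraph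

theorem theorem9 {V : Type*} [Fintype V] (G : SimpleGraph V) [DecidableRel G.Adj]
    (hconn : G.IsTwoConnected) (hcycle : ¬ G.IsCycleGraph)
    (hclaw : G.IsFHeavy SimpleGraph.claw 1) (hZ : G.IsFHeavy (SimpleGraph.zGraph 1) 1) :
    G.IsPancyclic := by
  have hstar := SimpleGraph.isLightCoherent_of_isFHeavy hclaw hZ
  have hH : ∃ h, G.IsHeavy h := by
    by_contra! hL
    exact hcycle (hconn.isCycleGraph_of_not_isHeavy hstar hL)
  by_cases hcl : G.HasLightCliques
  · obtain ⟨g, hg⟩ := hconn.exists_isHamOrder hstar hcl hH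
    obtain ⟨i, h0, h1⟩ := hg.exists_consecutive_isHeavy hconn.1 hstar hcl hH
    exact hg.isPancyclic_of_isHeavy h0 h1
  · unfold SimpleGraph.HasLightCliques at hcl
    push Not at hcl
    obtain ⟨h, a, c, hh, ha, hc, hha, hhc, hac, hnot⟩ := hcl
    exact hstar.isPancyclic_of_not_adj hconn hh ha hc hha hhc hac hnot
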